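/- Let $d\in\mathbb N$, $d\ge 2$, and let $\mathbb R^d=\mathbb R^{d-1}\times\mathbb R$ carry the Euclidean norm. A map $g\colon A\to\mathbb R^d$, $A\subseteq\mathbb R^d$, is $L$-bilipschitz, written $\operatorname{bilip}(g)\le L$, if $\frac1L\|x-y\|\le\|g(x)-g(y)\|\le L\|x-y\|$ for all $x,y\in A$, and bilipschitz if it is $L$-bilipschitz for some $L\in[1,\infty)$. Let $\mathcal F_d$ be the set of all monotone increasing (i.e. nondecreasing) functions $\psi\colon[1,\infty)\to[1,\infty)$ with the following property: for every integer $S\ge1$, with $Q:=(-\frac12,\dots,-\frac12)+[0,S]^{d-1}$, and every permutation $\sigma$ of $\mathbb Z^{d-1}$ that, for each $z\in\mathbb Z^{d-1}$, restricts to a permutation of $\mathbb Z^{d-1}\cap(Q+Sz)$, there is a $\psi(S)$-bilipschitz map $\Upsilon\colon\mathbb R^d\to\mathbb R^d$ with $\Upsilon(x)=x$ for all $x\in\mathbb R^{d-1}\times(\mathbb R\setminus(-\frac12,\frac12))$ and $\Upsilon(x,0)=(\sigma(x),0)$ for all $x\in\mathbb Z^{d-1}$. Let $\beta_d(t):=\inf_{\psi\in\mathcal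 F_d}\psi(t)$ for $t\in[1,\infty)$. Theorem 1.2. The function $\beta_d$ is a well-defined monotone increasing function $[1,\infty)\to[1,\infty)$ with $2\lfloor t\rfloor-1\le\beta_d(t)\le 2^{8dt}$ for all $t\in[1,\infty)$. Moreover, for every bilipschitz map $f\colon\mathbb Z^d\to\mathbb R^d$ the following two statements are equivalent: (i) There is a bilipschitz map $F\colon\mathbb R^d\to\mathbb R^d$ with $F|_{\mathbb Z^d}=f$. (ii) There are an integer $T\ge1$ and a bilipschitz map $G\colon\mathbb R^d\to\mathbb R^d$ such that the map $\widetilde F\colon\mathbb Z^d\cup\left(\mathbb R^{d-1}\times(T\mathbb Z+\frac12)\right)\to\mathbb R^d$, equal to $f$ on $\mathbb Z^d$ and to $G$ on $\mathbb R^{d-1}\times(T\mathbb Z+\frac12)$, is bilipschitz, and for every $k\in\mathbb Z$ $$f\left(\mathbb Z^d\cap\left(\mathbb R^{d-1}\times[(k-1)T+\tfrac12,kT+\tfrac12]\right)\right)\subseteq G\left(\mathbb R^{d-1}\times[(k-1)T+\tfrac12,kT+\tfrac12]\right).$$ Furthermore, whenever $T$ and $G$ are as in (ii), $M_1\ge\operatorname{bilip}(\widetilde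 F)$ and $M_2\ge\operatorname{bilip}(G)$, there is a bilipschitz $F\colon\mathbb R^d\to\mathbb R^d$ with $F|_{\mathbb Z^d}=f$ and $$\operatorname{bilip}(F)\le\beta_d\left(2^{42}d^{9/2}(M_1M_2)^{10}T^{3+\frac3{d-1}}\right)^{3^{d-1}+1}.$$ -/

import Mathlib

open Set

noncomputable section

namespace BilipExt

/-- `f` is `L`-bilipschitz: both `f` and its inverse (on the image of `f`) are `L`-Lipschitz.
Equivalently `f` is injective and `bilip(f) = max (Lip f) (Lip f⁻¹) ≤ L`. -/
def BilipschitzWith {α β : Type*} [MetricSpace α] [MetricSpace β] (L : ℝ) (f : α → β) : Prop :=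
  ∀ x y : α, dist (f x) (f y) ≤ L * dist x y ∧ dist x y ≤ L * dist (f x) (f y)

/-- `f` is bilipschitz if it is `L`-bilipschitz for some finite `L ≥ 1`. -/
def Bilipschitz {α β : Type*} [MetricSpace α] [MetricSpace β] (f : α → β) : Prop :=
  ∃ L : ℝ, 1 ≤ L ∧ BilipschitzWith L f

/-- Euclidean space `ℝ^d`. -/
abbrev E (d : ℕ) : Type := EuclideanSpace ℝ (Fin d)

/-- The last coordinate of a point of `ℝ^d = ℝ^{d-1} × ℝ` (for `d ≥ 1`). -/
def lastCoord {d : ℕ} (x : E d) : ℝ :=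
  if h : 0 < d then x ⟨d - 1, Nat.sub_lt h Nat.one_pos⟩ else 0

/-- The integer lattice `ℤ^d` in `ℝ^d`. -/
def intLattice (d : ℕ) : Set (E d) := {x | ∀ i, ∃ n : ℤ, x i = n}

/-- The family of hyperplanes `ℝ^{d-1} × (Tℤ + 1/2)`. -/
def hyperplanes (d T : ℕ) : Set (E d) := {x | ∃ k : ℤ, lastCoord x = T * k + 1 / 2}

/-- The closed slab `ℝ^{d-1} × [(k-1)T + 1/2, kT + 1/2]`. -/
def slab (d T : ℕ) (k : ℤ) : Set (E d) :=
  {x | lastCoord x ∈ Icc (((k : ℝ) - 1) * T + 1 / 2) ((k : ℝ) * T + 1 / 2)}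

open Classical in
/-- The map on `ℤ^d ∪ (ℝ^{d-1} × (Tℤ + 1/2))` which is `f` on the lattice and `G` on the
hyperplanes. -/
def joint {d : ℕ} (f : intLattice d → E d) (G : E d → E d) (T : ℕ) :
    ↥(intLattice d ∪ hyperplanes d T) → E d :=
  fun x => if h : (x : E d) ∈ intLattice d then f ⟨x, h⟩ else G x

/-- The images of the lattice points of each closed slab lie in the `G`-image of that slab. -/
def SlabCompatible {d : ℕ} (f : intLattice d → E d) (G : E d → E d) (T : ℕ) : Prop :=
  ∀ k : ℤ, f '' {x | (x : E d) ∈ slab d T k} ⊆ G '' slab d T k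

/-- The lattice points of `ℤ^{d-1}` in the tile `Q + S z`,
where `Q = (-1/2, …, -1/2) + [0, S]^{d-1}`. -/
def tile (d S : ℕ) (z : Fin (d - 1) → ℤ) : Set (Fin (d - 1) → ℤ) :=
  {p | ∀ i, (p i : ℝ) ∈ Icc (-(1 / 2) + S * (z i : ℝ)) (-(1 / 2) + S + S * (z i : ℝ))}

/-- The point `(p, 0) ∈ ℝ^{d-1} × ℝ = ℝ^d` for `p ∈ ℤ^{d-1}`. -/
def atHeightZero {d : ℕ} (p : Fin (d - 1) → ℤ) : E d :=
  WithLp.toLp 2 fun i => if h : (i : ℕ) < d - 1 then (p ⟨i, h⟩ : ℝ) else 0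

/-- Every permutation of `ℤ^{d-1}` that preserves each tile of side `S` is realised on
`ℤ^{d-1} × {0}` by a `ψ(S)`-bilipschitz self-map of `ℝ^d` that is the identity outside
`ℝ^{d-1} × (-1/2, 1/2)`. -/
def RealisesTilePerms (d : ℕ) (ψ : ℝ → ℝ) : Prop :=
  ∀ S : ℕ, 1 ≤ S → ∀ σ : Equiv.Perm (Fin (d - 1) → ℤ),
    (∀ z : Fin (d - 1) → ℤ, BijOn σ (tile d S z) (tile d S z)) →
    ∃ Υ : E d → E d, BilipschitzWith (ψ S) Υ ∧
      (∀ x : E d, lastCoord x ∉ Ioo (-(1 / 2) : ℝ) (1 / 2) → Υ x = x) ∧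
      ∀ p : Fin (d - 1) → ℤ, Υ (atHeightZero p) = atHeightZero (σ p)

/-- The monotone increasing functions `ψ : [1, ∞) → [1, ∞)` (given as real functions, of which
only the values on `[1, ∞)` matter) that realise all tile-preserving permutations. -/
def permFamily (d : ℕ) : Set (ℝ → ℝ) :=
  {ψ | MapsTo ψ (Ici 1) (Ici 1) ∧ MonotoneOn ψ (Ici 1) ∧ RealisesTilePerms d ψ}

/-- `β_d`, the pointwise infimum of the family above. -/
def betaFun (d : ℕ) (t : ℝ) : ℝ := sInf ((fun ψ : ℝ → ℝ => ψ t) '' permFamily d)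

end BilipExt

end

namespace BilipExt

/-! The core is `exists_bilipschitz_extension`: a separated map on `ℤ^d` that moves points a bounded
distance extends to a bilipschitz self-map of `ℝ^d`, with an explicit constant. Given (ii), write `f
n = G (g n)`. The hyperplanes, on which the joint map is `G`, force `g n` to stay near `n`, and the
bilipschitz bounds make `g` separated. Extending `g` to `Φ` gives `F = G ∘ Φ`.

The extension is a composition of shears (`exists_bilipschitz_shift`), each moving some coordinates
by a displacement that contracts by `1/2` in the moving coordinates but may be steep in the fixed
ones. Points are coloured by residues. Distinct points of one colour are so far apart that the
displacement between them is harmless; points of different colours are told apart by a fixed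
coordinate into which the colour has been encoded. With the last coordinate as encoder, the same
device realises tile permutations, which bounds `β_d` above.

The quantitative bound then needs only `β_d(t) ≥ 2⌊t⌋ - 1 ≥ t` for `t ≥ 3`: the power of `β_d`
dominates the constant of `G ∘ Φ`. -/

theorem BilipschitzWith.comp {α β γ : Type*} [MetricSpace α] [MetricSpace β] [MetricSpace γ]
    {K L : ℝ} {g : β → γ} {f : α → β} (hg : BilipschitzWith K g) (hf : BilipschitzWith L f)
    (hK : 0 ≤ K) (hL : 0 ≤ L) : BilipschitzWith (K * L) (g ∘ f) := fun x y => by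
  have h₁ := hf x y
  have h₂ := hg (f x) (f y)
  constructor
  · calc dist (g (f x)) (g (f y)) ≤ K * dist (f x) (f y) := h₂.1
      _ ≤ K * (L * dist x y) := mul_le_mul_of_nonneg_left h₁.1 hK
      _ = K * L * dist x y := by ring
  · calc dist x y ≤ L * dist (f x) (f y) := h₁.2
      _ ≤ L * (K * dist (g (f x)) (g (f y))) := mul_le_mul_of_nonneg_left h₂.2 hL
      _ = K * L * dist (g (f x)) (g (f y)) := by ring

theorem BilipschitzWith.mono {α β : Type*} [MetricSpace α] [MetricSpace β]
    {K L : ℝ} {f : α → β} (hf : BilipschitzWith K f) (h : K ≤ L) : BilipschitzWith L f :=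
  fun x y => ⟨(hf x y).1.trans (mul_le_mul_of_nonneg_right h dist_nonneg),
    (hf x y).2.trans (mul_le_mul_of_nonneg_right h dist_nonneg)⟩

/-! ### Shears with prescribed displacements -/

/-- A family of points can be moved within the coordinates in `A` by a bilipschitz map,
provided the displacement is `1/2`-Lipschitz in the coordinates from `A` and `K`-Lipschitz in the
others. -/
theorem exists_bilipschitz_shift {ι J : Type*} [Fintype ι] (A : Set ι) {K : ℝ} (hK : 1 ≤ K)
    (a b : J → ι → ℝ) (hfix : ∀ j, ∀ i ∉ A, b j i = a j i)
    (hdisp : ∀ j j', j ≠ j' →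
      (∃ k ∈ A, ∀ i, |(b j i - a j i) - (b j' i - a j' i)| ≤ 1 / 2 * |a j k - a j' k|) ∨
      (∃ k ∉ A, ∀ i, |(b j i - a j i) - (b j' i - a j' i)| ≤ K * |a j k - a j' k|)) :
    ∃ Φ : (ι → ℝ) → (ι → ℝ), BilipschitzWith (1 + K) Φ ∧ ∀ j, Φ (a j) = b j := by
  classical
  -- In the supremum norm weighted by `w`, the hypothesis `hdisp` says that the displacement is
  -- 1-Lipschitz.
  let w : ι → ℝ := fun k => if k ∈ A then 1 / 2 else K
  let W : (ι → ℝ) → (ι → ℝ) := fun x k => w k * x k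
  let v : J → ι → ℝ := fun j i => b j i - a j i
  have hw : ∀ k, 0 ≤ w k := fun k => by
    simp only [w]; split_ifs <;> linarith
  have hWk : ∀ x y : ι → ℝ, ∀ k, dist (W x k) (W y k) = w k * |x k - y k| := fun x y k => by
    simp only [W, Real.dist_eq, ← mul_sub, abs_mul, abs_of_nonneg (hw k)]
  have hv : ∀ j j', dist (v j) (v j') ≤ dist (W (a j)) (W (a j')) := fun j j' => by
    rcases eq_or_ne j j' with rfl | hne
    · simp
    · refine (dist_pi_le_iff dist_nonneg).2 fun i => ?_
      rcases hdisp j j' hne with ⟨k, hk, h⟩ | ⟨k, hk, h⟩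
      · refine le_trans ?_ (dist_le_pi_dist _ _ k)
        rw [hWk, Real.dist_eq]
        simpa [w, hk, v] using h i
      · refine le_trans ?_ (dist_le_pi_dist _ _ k)
        rw [hWk, Real.dist_eq]
        simpa [w, hk, v] using h i
  let f : (ι → ℝ) → (ι → ℝ) := fun y => if h : ∃ j, W (a j) = y then v h.choose else 0
  have hfv : ∀ j, f (W (a j)) = v j := fun j => by
    have h : ∃ j', W (a j') = W (a j) := ⟨j, rfl⟩
    have h₂ := hv h.choose j
    rw [h.choose_spec, dist_self] at h₂
    simp only [f, dif_pos h]
    exact dist_le_zero.1 h₂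
  have hf : LipschitzOnWith 1 f (range fun j => W (a j)) := by
    refine LipschitzOnWith.of_dist_le_mul ?_
    rintro _ ⟨j, rfl⟩ _ ⟨j', rfl⟩
    simpa [hfv] using hv j j'
  -- Extending each coordinate separately costs nothing in the supremum norm, so the constant stays
  -- 1.
  obtain ⟨g, hg, hgf⟩ := hf.extend_pi
  have hgv : ∀ j, g (W (a j)) = v j := fun j => by
    rw [← hfv j]; exact (hgf ⟨j, rfl⟩).symm
  let Φ : (ι → ℝ) → (ι → ℝ) := fun x i => if i ∈ A then x i + g (W x) i else x i
  have hgi : ∀ x y i, |g (W x) i - g (W y) i| ≤ dist (W x) (W y) := fun x y i => by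
    have := (dist_le_pi_dist (g (W x)) (g (W y)) i).trans (hg.dist_le_mul (W x) (W y))
    simpa [Real.dist_eq] using this
  refine ⟨Φ, fun x y => ⟨?_, ?_⟩, fun j => ?_⟩
  · have hW : dist (W x) (W y) ≤ K * dist x y := by
      refine (dist_pi_le_iff (by positivity)).2 fun k => ?_
      rw [hWk]
      refine mul_le_mul ?_ (dist_le_pi_dist x y k) (abs_nonneg _) (by linarith)
      simp only [w]; split_ifs <;> linarith
    refine (dist_pi_le_iff (by positivity)).2 fun i => ?_
    have hi : |x i - y i| ≤ dist x y := dist_le_pi_dist x y i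
    have hd : 0 ≤ dist x y := dist_nonneg
    simp only [Φ, Real.dist_eq]
    split_ifs
    · calc |x i + g (W x) i - (y i + g (W y) i)|
          = |(x i - y i) + (g (W x) i - g (W y) i)| := by ring_nf
        _ ≤ |x i - y i| + |g (W x) i - g (W y) i| := abs_add_le _ _
        _ ≤ (1 + K) * dist x y := by linarith [hgi x y i]
    · nlinarith
  · set D := dist (Φ x) (Φ y) with hD
    have hD0 : 0 ≤ D := dist_nonneg
    have hΦi : ∀ i, |Φ x i - Φ y i| ≤ D := fun i => dist_le_pi_dist (Φ x) (Φ y) i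
    -- Coordinates outside `A` are unchanged by `Φ`, hence controlled by `D`; those in `A` carry
    -- weight `1/2`, which is absorbed into the left side of `hxy`.
    have hW : dist (W x) (W y) ≤ max (1 / 2 * dist x y) (K * D) := by
      refine (dist_pi_le_iff (le_max_of_le_right (by positivity))).2 fun k => ?_
      rw [hWk]
      by_cases hk : k ∈ A
      · refine le_max_of_le_left ?_
        have : |x k - y k| ≤ dist x y := dist_le_pi_dist x y k
        simp only [w, hk, if_true]
        linarith
      · refine le_max_of_le_right ?_
        have := hΦi k
        simp only [Φ, hk, if_false] at this
        simp only [w, hk, if_false]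
        gcongr
    have hxy : dist x y ≤ D + max (1 / 2 * dist x y) (K * D) := by
      refine (dist_pi_le_iff (by positivity)).2 fun i => ?_
      have h := hΦi i
      rw [Real.dist_eq]
      by_cases hi : i ∈ A
      · simp only [Φ, hi, if_true] at h
        calc |x i - y i| = |(x i + g (W x) i - (y i + g (W y) i)) - (g (W x) i - g (W y) i)| := by
              ring_nf
          _ ≤ |x i + g (W x) i - (y i + g (W y) i)| + |g (W x) i - g (W y) i| := abs_sub _ _
          _ ≤ _ := add_le_add h ((hgi x y i).trans hW)
      · simp only [Φ, hi, if_false] at h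
        exact h.trans (le_add_of_nonneg_right (le_max_of_le_right (by positivity)))
    rcases max_cases (1 / 2 * dist x y) (K * D) with ⟨h, _⟩ | ⟨h, _⟩ <;> rw [h] at hxy <;> nlinarith
  · funext i
    by_cases hi : i ∈ A
    · simp [Φ, hi, hgv, v]
    · simp [Φ, hi, hfix j i hi]

/-- A version of `exists_bilipschitz_shift` in which the points of `Z` are kept fixed. -/
theorem exists_bilipschitz_shift_fixing {ι J : Type*} [Fintype ι] (A : Set ι) {K : ℝ} (hK : 1 ≤ K)
    (a b : J → ι → ℝ) (Z : Set (ι → ℝ)) (hfix : ∀ j, ∀ i ∉ A, b j i = a j i)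
    (hdisp : ∀ j j', j ≠ j' →
      (∃ k ∈ A, ∀ i, |(b j i - a j i) - (b j' i - a j' i)| ≤ 1 / 2 * |a j k - a j' k|) ∨
      (∃ k ∉ A, ∀ i, |(b j i - a j i) - (b j' i - a j' i)| ≤ K * |a j k - a j' k|))
    (hZ : ∀ j, ∀ z ∈ Z, (∃ k ∈ A, ∀ i, |b j i - a j i| ≤ 1 / 2 * |a j k - z k|) ∨
      (∃ k ∉ A, ∀ i, |b j i - a j i| ≤ K * |a j k - z k|)) :
    ∃ Φ : (ι → ℝ) → (ι → ℝ), BilipschitzWith (1 + K) Φ ∧ (∀ j, Φ (a j) = b j) ∧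
      ∀ z ∈ Z, Φ z = z := by
  obtain ⟨Φ, hΦ, h⟩ := exists_bilipschitz_shift (J := J ⊕ Z) A hK
    (Sum.elim a Subtype.val) (Sum.elim b Subtype.val)
    (by rintro (j | z) i hi
        · exact hfix j i hi
        · rfl)
    (by rintro (j | z) (j' | z') hne
        · exact hdisp j j' fun h => hne (h ▸ rfl)
        · simpa using hZ j z' z'.2
        · simpa [abs_sub_comm] using hZ j' z z.2
        -- Two fixed points have equal displacement, so any coordinate is a witness; one exists
        -- because the points differ.
        · by_cases hA : A.Nonempty
          · exact Or.inl ⟨hA.some, hA.some_mem, fun i => by simp⟩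
          · obtain ⟨k, -⟩ := Function.ne_iff.1 fun h => hne (congrArg Sum.inr (Subtype.ext h))
            exact Or.inr ⟨k, fun hk => hA ⟨k, hk⟩, fun i => by
              simp only [Sum.elim_inr, sub_self, abs_zero]; positivity⟩)
  exact ⟨Φ, hΦ, fun j => h (Sum.inl j), fun z hz => h (Sum.inr ⟨z, hz⟩)⟩

/-! ### Supremum norm versus Euclidean norm -/

theorem dist_ofLp_le {d : ℕ} (x y : E d) : dist x.ofLp y.ofLp ≤ dist x y :=
  (dist_pi_le_iff dist_nonneg).2 fun i => PiLp.dist_apply_le x y i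

theorem dist_le_mul_dist_ofLp {d : ℕ} (x y : E d) : dist x y ≤ d * dist x.ofLp y.ofLp := by
  rw [EuclideanSpace.dist_eq]
  refine Real.sqrt_le_iff.2 ⟨by positivity, ?_⟩
  calc ∑ i, dist (x.ofLp i) (y.ofLp i) ^ 2
      ≤ ∑ _i : Fin d, dist x.ofLp y.ofLp ^ 2 := by
        gcongr with i
        exact dist_le_pi_dist x.ofLp y.ofLp i
    _ = d * dist x.ofLp y.ofLp ^ 2 := by simp
    _ ≤ (d * dist x.ofLp y.ofLp) ^ 2 := by
        rw [mul_pow]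
        gcongr
        exact_mod_cast Nat.le_self_pow two_ne_zero d

/-- A bilipschitz map for the supremum norm is bilipschitz for the Euclidean norm. -/
theorem BilipschitzWith.toEuclidean {d : ℕ} {C : ℝ} (hC : 0 ≤ C) {Φ : (Fin d → ℝ) → (Fin d → ℝ)}
    (hΦ : BilipschitzWith C Φ) :
    BilipschitzWith (d * C) fun x : E d => (WithLp.toLp 2 (Φ x.ofLp) : E d) := by
  intro x y
  have h := hΦ x.ofLp y.ofLp
  have h₁ := dist_ofLp_le x y
  have h₂ := dist_ofLp_le (WithLp.toLp 2 (Φ x.ofLp) : E d) (WithLp.toLp 2 (Φ y.ofLp))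
  constructor
  · calc dist (WithLp.toLp 2 (Φ x.ofLp) : E d) (WithLp.toLp 2 (Φ y.ofLp))
        ≤ d * dist (Φ x.ofLp) (Φ y.ofLp) := dist_le_mul_dist_ofLp _ _
      _ ≤ d * (C * dist x y) := by gcongr; exact h.1.trans (by gcongr)
      _ = d * C * dist x y := by ring
  · calc dist x y ≤ d * dist x.ofLp y.ofLp := dist_le_mul_dist_ofLp x y
      _ ≤ d * (C * dist (WithLp.toLp 2 (Φ x.ofLp) : E d) (WithLp.toLp 2 (Φ y.ofLp))) := by
          gcongr; exact h.2.trans (by gcongr)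
      _ = _ := by ring

/-- Two distinct points rule out `L < 1`, since the two inequalities would contradict each other.
This recovers `1 ≤ M₁` and `1 ≤ M₂`, which the quantitative statement does not assume. -/
theorem one_le_of_bilipschitzWith {α β : Type*} [MetricSpace α] [MetricSpace β] {L : ℝ}
    {f : α → β} (hf : BilipschitzWith L f) {x y : α} (hxy : x ≠ y) : 1 ≤ L := by
  have h := hf x y
  have h₁ : 0 < dist x y := dist_pos.2 hxy
  have h₂ : 0 < L := by
    by_contra! hL
    nlinarith [h.2, dist_nonneg (x := f x) (y := f y)]
  by_contra! hL
  have h₃ : L * dist x y < dist x y := mul_lt_of_lt_one_left h₁ hL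
  have h₄ : L * dist (f x) (f y) ≤ dist (f x) (f y) :=
    mul_le_of_le_one_left dist_nonneg hL.le
  linarith

/-! ### Colours and their encoding in one coordinate -/

/-- A colouring of `ℤ^ι` by residues modulo `R`. -/
theorem exists_residue_colouring (ι : Type*) [Fintype ι] {R : ℕ} (hR : 0 < R) :
    ∃ c : (ι → ℤ) → ℕ, (∀ n, c n < R ^ Fintype.card ι) ∧
      ∀ n m, n ≠ m → c n = c m → ∃ i, (R : ℝ) ≤ |(n i : ℝ) - m i| := by
  classical
  have : NeZero R := ⟨hR.ne'⟩
  let e := Fintype.equivFin (ι → ZMod R)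
  refine ⟨fun n => e fun i => (n i : ZMod R), fun n => ?_, fun n m hne h => ?_⟩
  · have := (e fun i => (n i : ZMod R)).2
    simpa [ZMod.card] using this
  · obtain ⟨i, hi⟩ := Function.ne_iff.1 hne
    have h' := congrFun (e.injective (Fin.ext h)) i
    have hdvd := (ZMod.intCast_eq_intCast_iff_dvd_sub _ _ _).1 h'.symm
    refine ⟨i, ?_⟩
    have := Int.le_of_dvd (abs_pos.2 (sub_ne_zero.2 hi)) ((dvd_abs _ _).2 hdvd)
    exact_mod_cast this

/-- Every real number is close to a multiple of `s` with prescribed residue modulo `N`. -/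
theorem exists_near_residue {s : ℝ} (hs : 0 < s) {N : ℕ} (hN : 0 < N) (c : ℕ) (y : ℝ) :
    ∃ m : ℤ, |s * ((N : ℝ) * m + c) - y| ≤ s * N := by
  have hN' : (0 : ℝ) < N := by exact_mod_cast hN
  refine ⟨⌊(y / s - c) / N⌋, ?_⟩
  have h₁ := Int.floor_le ((y / s - c) / N)
  have h₂ := Int.lt_floor_add_one ((y / s - c) / N)
  rw [le_div_iff₀ hN', le_sub_iff_add_le, le_div_iff₀ hs] at h₁
  rw [div_lt_iff₀ hN', sub_lt_iff_lt_add, div_lt_iff₀ hs] at h₂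
  rw [abs_le]
  constructor <;> nlinarith

theorem one_le_abs_of_residue_ne {N c c' : ℕ} (hc : c < N) (hc' : c' < N) (hne : c ≠ c')
    (m m' : ℤ) : (1 : ℝ) ≤ |((N : ℝ) * m + c) - (N * m' + c')| := by
  have h : (N : ℤ) * m + c - (N * m' + c') ≠ 0 := fun h => by
    have h₁ : (c : ℤ) % N = c' % N := by
      have : (c : ℤ) = c' + N * (m' - m) := by linarith
      rw [this, Int.add_mul_emod_self_left]
    rw [Int.emod_eq_of_lt (by omega) (by omega), Int.emod_eq_of_lt (by omega) (by omega)] at h₁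
    omega
  exact_mod_cast Int.one_le_abs h

/-! ### Extension of lattice maps of bounded displacement -/

/-- A separated map on `ℤ^ι` with bounded displacement extends to a bilipschitz self-map of `ℝ^ι`
as soon as `ι` has two elements. -/
theorem exists_bilipschitz_extension {ι : Type*} [Fintype ι] {k l : ι} (hkl : k ≠ l)
    (b : (ι → ℤ) → ι → ℝ) {D δ : ℝ} (hδ : 0 < δ) (hδ1 : δ ≤ 1)
    (hD : ∀ n i, |b n i - n i| ≤ D) (hsep : ∀ n m, n ≠ m → ∃ i, δ ≤ |b n i - b m i|)
    {R : ℕ} (hR : 4 * (D + 1) ≤ R) :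
    ∃ Φ : (ι → ℝ) → (ι → ℝ),
      BilipschitzWith (4 * (1 + 4 * (R : ℝ) ^ Fintype.card ι * (D + 1)) *
        (1 + 16 * (R : ℝ) ^ Fintype.card ι * (D + 1) / δ)) Φ ∧
      ∀ n : ι → ℤ, Φ (fun i => n i) = b n := by
  classical
  have hD0 : 0 ≤ D := (abs_nonneg _).trans (hD 0 k)
  have hR0 : 0 < R := by
    have : (0 : ℝ) < R := by linarith
    exact_mod_cast this
  obtain ⟨c, hcN, hc⟩ := exists_residue_colouring ι hR0
  set N : ℕ := R ^ Fintype.card ι with hNdef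
  have hNpos : 0 < N := pow_pos hR0 _
  have hN1 : (1 : ℝ) ≤ N := by exact_mod_cast hNpos
  have hNcast : (R : ℝ) ^ Fintype.card ι = N := by simp [hNdef]
  rw [hNcast]
  -- Adding `ε n` encodes the colour in coordinate `k`, as a residue modulo `2N` in units of
  -- `1/(2N)`; `ε ≤ 1/2` is small against the unit spacing of the lattice.
  set ε : (ι → ℤ) → ℝ := fun n => c n / (2 * N) with hε
  have hε0 : ∀ n, 0 ≤ ε n := fun n => by positivity
  have hε1 : ∀ n, ε n ≤ 1 / 2 := fun n => by
    have : (c n : ℝ) ≤ N := by exact_mod_cast (hcN n).le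
    simp only [hε]
    rw [div_le_iff₀ (by positivity)]
    linarith
  have hεabs : ∀ n m, |ε n - ε m| ≤ 1 / 2 := fun n m =>
    abs_le.2 ⟨by linarith [hε0 n, hε1 m], by linarith [hε0 m, hε1 n]⟩
  -- The grid step is chosen so that rounding `b n l` to a grid point of residue `c n` costs at most
  -- `s * N = δ / 8`.
  set s : ℝ := δ / (8 * N) with hs
  have hs0 : 0 < s := by positivity
  have hsN : s * N = δ / 8 := by rw [hs]; field_simp
  choose q hq using fun n => exists_near_residue hs0 hNpos (c n) (b n l)
  set y : (ι → ℤ) → ℝ := fun n => s * ((N : ℝ) * q n + c n) with hy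
  have hyb : ∀ n, |y n - b n l| ≤ δ / 8 := fun n => hsN ▸ hq n
  have hyD : ∀ n, |y n - n l| ≤ D + 1 := fun n => by
    have h₁ := abs_le.1 (hyb n)
    have h₂ := abs_le.1 (hD n l)
    exact abs_le.2 ⟨by linarith, by linarith⟩
  have hysep : ∀ n m, c n ≠ c m → s ≤ |y n - y m| := fun n m h => by
    simp only [hy]
    rw [← mul_sub, abs_mul, abs_of_pos hs0]
    exact le_mul_of_one_le_right hs0.le (one_le_abs_of_residue_ne (hcN n) (hcN m) h _ _)
  -- Route from the lattice to `b`: encode the colour in `k`, move coordinate `l` to a colour-coded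
  -- approximation of its target, move all other coordinates to their targets, then correct `l`.
  let a₀ : (ι → ℤ) → ι → ℝ := fun n i => n i
  let a₁ : (ι → ℤ) → ι → ℝ := fun n i => if i = k then n k + ε n else n i
  let a₂ : (ι → ℤ) → ι → ℝ := fun n i => if i = l then y n else a₁ n i
  let a₃ : (ι → ℤ) → ι → ℝ := fun n i => if i = l then y n else b n i
  have h1k : ∀ n m, c n ≠ c m → 1 / (2 * (N : ℝ)) ≤ |a₁ n k - a₁ m k| := fun n m h => by
    have h' := one_le_abs_of_residue_ne (N := 2 * N) ((hcN n).trans_le (by omega))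
      ((hcN m).trans_le (by omega)) h (n k) (m k)
    have e : a₁ n k - a₁ m k =
        (((2 * N : ℕ) * (n k : ℝ) + c n) - ((2 * N : ℕ) * m k + c m)) / (2 * N) := by
      simp only [a₁, if_true, hε]
      push_cast
      field_simp
    rw [e, abs_div, abs_of_pos (by positivity : (0 : ℝ) < 2 * N)]
    gcongr
  have h1c : ∀ n m, c n = c m → ∀ i, a₁ n i - a₁ m i = n i - m i := fun n m h i => by
    by_cases hi : i = k
    · simp [a₁, hi, hε, h]
    · simp [a₁, hi]
  have habs : ∀ {u v C : ℝ}, |u| ≤ C → |v| ≤ C → |u - v| ≤ 2 * C := fun hu hv =>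
    (abs_sub _ _).trans (by linarith)
  obtain ⟨Φ₁, hΦ₁, hm₁⟩ := exists_bilipschitz_shift univ le_rfl a₀ a₁ (by simp) fun n m hne => by
    obtain ⟨i, hi⟩ := Function.ne_iff.1 hne
    refine Or.inl ⟨i, mem_univ i, fun j => ?_⟩
    have h₁ : (1 : ℝ) ≤ |(n i : ℝ) - m i| := by
      exact_mod_cast Int.one_le_abs (sub_ne_zero.2 hi)
    have h₂ : |(a₁ n j - a₀ n j) - (a₁ m j - a₀ m j)| ≤ 1 / 2 := by
      by_cases hj : j = k
      · subst hj; simpa [a₁, a₀] using hεabs n m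
      · simp [a₁, a₀, hj]
    exact h₂.trans (by simp only [a₀]; linarith)
  -- Coordinate `k` stays fixed and separates colours by `1/(2N)`, whence `K = 4N(D+1)`. Within a
  -- colour, `R ≥ 4(D+1)` beats the displacement difference `2(D+1)`.
  obtain ⟨Φ₂, hΦ₂, hm₂⟩ := exists_bilipschitz_shift {l} (K := 4 * N * (D + 1)) (by nlinarith) a₁ a₂
      (fun n i hi => if_neg hi) fun n m hne => by
    have hv : ∀ n i, |a₂ n i - a₁ n i| ≤ D + 1 := fun n i => by
      by_cases hi : i = l
      · subst hi; simpa [a₂, a₁, hkl.symm] using hyD n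
      · simp only [a₂, if_neg hi, sub_self, abs_zero]; linarith
    have hvv : ∀ i, |(a₂ n i - a₁ n i) - (a₂ m i - a₁ m i)| ≤ 2 * (D + 1) := fun i =>
      habs (hv n i) (hv m i)
    by_cases hcc : c n = c m
    · obtain ⟨i, hi⟩ := hc n m hne hcc
      rw [← h1c n m hcc] at hi
      by_cases hil : i = l
      · exact Or.inl ⟨i, hil, fun j => (hvv j).trans (by linarith)⟩
      · refine Or.inr ⟨i, hil, fun j => (hvv j).trans ?_⟩
        have h₁ : 2 * (D + 1) ≤ |a₁ n i - a₁ m i| := by linarith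
        exact h₁.trans (le_mul_of_one_le_left (abs_nonneg _) (by nlinarith))
    · refine Or.inr ⟨k, hkl, fun j => (hvv j).trans ?_⟩
      calc 2 * (D + 1) = 4 * N * (D + 1) * (1 / (2 * N)) := by field_simp; norm_num
        _ ≤ _ := by gcongr; exact h1k n m hcc
  have hK₃ : 1 ≤ 16 * N * (D + 1) / δ := by
    rw [le_div_iff₀ hδ]; nlinarith
  -- Now `l` is the fixed encoder, separating colours by `s`.
  obtain ⟨Φ₃, hΦ₃, hm₃⟩ := exists_bilipschitz_shift {l}ᶜ hK₃ a₂ a₃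
      (fun n i hi => by simp [a₂, a₃, show i = l by simpa using hi]) fun n m hne => by
    have hv : ∀ n i, |a₃ n i - a₂ n i| ≤ D + 1 := fun n i => by
      by_cases hi : i = l
      · simp only [a₂, a₃, if_pos hi, sub_self, abs_zero]; linarith
      · have h := abs_le.1 (hD n i)
        by_cases hik : i = k
        · subst hik
          simp only [a₃, a₂, a₁, if_neg hi, if_true]
          exact abs_le.2 ⟨by linarith [hε1 n], by linarith [hε0 n]⟩
        · simp only [a₃, a₂, a₁, if_neg hi, if_neg hik]
          exact abs_le.2 ⟨by linarith, by linarith⟩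
    have hvv : ∀ i, |(a₃ n i - a₂ n i) - (a₃ m i - a₂ m i)| ≤ 2 * (D + 1) := fun i =>
      habs (hv n i) (hv m i)
    by_cases hcc : c n = c m
    · obtain ⟨i, hi⟩ := hc n m hne hcc
      by_cases hil : i = l
      · subst hil
        refine Or.inr ⟨i, by simp, fun j => (hvv j).trans ?_⟩
        -- Separation by `R` in coordinate `l` partly survives the previous move: at least `R -
        -- 2(D+1)` remains.
        have h₁ : 2 * (D + 1) ≤ |y n - y m| := by
          have h₂ : |(n i : ℝ) - m i| ≤ |y n - y m| + 2 * (D + 1) := by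
            have h₃ := habs (hyD n) (hyD m)
            calc |(n i : ℝ) - m i| = |(y n - y m) - ((y n - n i) - (y m - m i))| := by ring_nf
              _ ≤ _ := (abs_sub _ _).trans (by linarith)
          linarith
        simp only [a₂, if_true]
        exact h₁.trans (le_mul_of_one_le_left (abs_nonneg _) hK₃)
      · refine Or.inl ⟨i, hil, fun j => (hvv j).trans ?_⟩
        rw [← h1c n m hcc] at hi
        simp only [a₂, if_neg hil]
        linarith
    · refine Or.inr ⟨l, by simp, fun j => (hvv j).trans ?_⟩
      simp only [a₂, if_true]
      calc 2 * (D + 1) = 16 * N * (D + 1) / δ * s := by rw [hs]; field_simp; norm_num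
        _ ≤ _ := by gcongr; exact hysep n m hcc
  -- Displacements differ by at most `δ/4`, while the points `a₃` remain `3δ/4`-separated.
  obtain ⟨Φ₄, hΦ₄, hm₄⟩ := exists_bilipschitz_shift univ le_rfl a₃ b (by simp) fun n m hne => by
    obtain ⟨i, hi⟩ := hsep n m hne
    refine Or.inl ⟨i, mem_univ i, fun j => ?_⟩
    have hv : ∀ n j, |a₃ n j - b n j| ≤ δ / 8 := fun n j => by
      by_cases hj : j = l
      · subst hj; simpa [a₃] using hyb n
      · simp only [a₃, if_neg hj, sub_self, abs_zero]; positivity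
    have h₁ : ∀ j, |(a₃ n j - b n j) - (a₃ m j - b m j)| ≤ δ / 4 := fun j =>
      (habs (hv n j) (hv m j)).trans (by linarith)
    have h₂ : |b n i - b m i| ≤ |a₃ n i - a₃ m i| + δ / 4 := by
      calc |b n i - b m i| = |(a₃ n i - a₃ m i) - ((a₃ n i - b n i) - (a₃ m i - b m i))| := by
            ring_nf
        _ ≤ _ := (abs_sub _ _).trans (by linarith [h₁ i])
    calc |(b n j - a₃ n j) - (b m j - a₃ m j)| = |(a₃ n j - b n j) - (a₃ m j - b m j)| := by
          rw [← abs_neg]; ring_nf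
      _ ≤ δ / 4 := h₁ j
      _ ≤ _ := by linarith
  refine ⟨Φ₄ ∘ Φ₃ ∘ Φ₂ ∘ Φ₁, ?_, fun n => ?_⟩
  · have h₂ := hΦ₂.comp hΦ₁ (by positivity) (by norm_num)
    have h₃ := hΦ₃.comp h₂ (by positivity) (by positivity)
    exact (hΦ₄.comp h₃ (by norm_num) (by positivity)).mono (le_of_eq (by ring))
  · simp only [Function.comp]
    rw [show (fun i => (n i : ℝ)) = a₀ n from rfl, hm₁, hm₂, hm₃, hm₄]

/-! ### Realising tile permutations: the upper bound for `β_d` -/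

theorem lastCoord_eq {d : ℕ} (hd : 0 < d) (x : E d) : lastCoord x = x ⟨d - 1, by omega⟩ :=
  dif_pos hd

/-- Tile faces lie at half-integers and meet no lattice point, so the closed tiles partition the
lattice into blocks read off by floor division. -/
theorem mem_tile_iff {d S : ℕ} (hS : 1 ≤ S) {z p : Fin (d - 1) → ℤ} :
    p ∈ tile d S z ↔ ∀ i, p i / S = z i := by
  refine forall_congr' fun i => ?_
  have hS' : (0 : ℤ) < S := by exact_mod_cast hS
  have h : p i / S = z i ↔ S * z i ≤ p i ∧ p i < S * z i + S := by
    rw [Int.ediv_eq_iff_of_pos hS']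
    constructor <;> rintro ⟨h₁, h₂⟩ <;> constructor <;> linarith
  rw [h, mem_Icc]
  constructor
  · rintro ⟨h₁, h₂⟩
    constructor
    · have : ((S * z i : ℤ) : ℝ) < (p i + 1 : ℤ) := by push_cast; linarith
      exact Int.lt_add_one_iff.1 (by exact_mod_cast this)
    · have : ((p i : ℤ) : ℝ) < (S * z i + S : ℤ) := by push_cast; linarith
      exact_mod_cast this
  · rintro ⟨h₁, h₂⟩
    have h₁' : (S : ℝ) * z i ≤ p i := by exact_mod_cast h₁
    have h₂' : (p i : ℝ) + 1 ≤ S * z i + S := by exact_mod_cast h₂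
    constructor <;> linarith

/-- Tile-preserving permutations are realised with polynomial bilipschitz constant. -/
theorem exists_realises_tile_perm {d : ℕ} (hd : 2 ≤ d) {S : ℕ} (hS : 1 ≤ S)
    (σ : Equiv.Perm (Fin (d - 1) → ℤ)) (hσ : ∀ z, BijOn σ (tile d S z) (tile d S z)) :
    ∃ Υ : E d → E d, BilipschitzWith (d * (4 * (1 + 16 * (4 * (S : ℝ)) ^ (d - 1) * S))) Υ ∧
      (∀ x : E d, lastCoord x ∉ Ioo (-(1 / 2) : ℝ) (1 / 2) → Υ x = x) ∧
      ∀ p : Fin (d - 1) → ℤ, Υ (atHeightZero p) = atHeightZero (σ p) := by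
  have hS1 : (1 : ℝ) ≤ S := by exact_mod_cast hS
  obtain ⟨c, hcN, hc⟩ := exists_residue_colouring (Fin (d - 1)) (R := 4 * S) (by omega)
  rw [Fintype.card_fin] at hcN
  set N : ℕ := (4 * S) ^ (d - 1) with hNdef
  have hN1 : (1 : ℝ) ≤ N := by exact_mod_cast Nat.pos_of_ne_zero (by positivity)
  have hNcast : (4 * (S : ℝ)) ^ (d - 1) = N := by simp [hNdef]
  rw [hNcast]
  -- Heights encode colours. Staying below `1/8` leaves a gap of `3/8` to the region `Z` to be
  -- fixed, enough for lifting and lowering to be `1/2`-Lipschitz.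
  set h : (Fin (d - 1) → ℤ) → ℝ := fun p => c p / (8 * N) with hh
  have h0 : ∀ p, 0 ≤ h p := fun p => by positivity
  have h1 : ∀ p, h p ≤ 1 / 8 := fun p => by
    have : (c p : ℝ) ≤ N := by exact_mod_cast (hcN p).le
    simp only [hh]
    rw [div_le_iff₀ (by positivity)]
    linarith
  have habs : ∀ p, |h p| ≤ 1 / 8 := fun p => by rw [abs_of_nonneg (h0 p)]; exact h1 p
  have hdiff : ∀ p q, |h p - h q| ≤ 1 / 8 := fun p q =>
    abs_le.2 ⟨by linarith [h0 p, h1 q], by linarith [h0 q, h1 p]⟩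
  have hsep : ∀ p q, c p ≠ c q → 1 / (8 * (N : ℝ)) ≤ |h p - h q| := fun p q hne => by
    have h' := one_le_abs_of_residue_ne (hcN p) (hcN q) hne 0 0
    have e : h p - h q = (((N : ℝ) * (0 : ℤ) + c p) - (N * (0 : ℤ) + c q)) / (8 * N) := by
      simp only [hh]; push_cast; ring
    rw [e, abs_div, abs_of_pos (by positivity : (0 : ℝ) < 8 * N)]
    gcongr
  have hmove : ∀ p i, |(σ p i : ℝ) - p i| ≤ S := fun p i => by
    have hp : p ∈ tile d S (fun i => p i / S) := (mem_tile_iff hS).2 fun _ => rfl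
    have h₁ := hp i
    have h₂ := (hσ _).mapsTo hp i
    exact abs_le.2 ⟨by linarith [h₁.2, h₂.1], by linarith [h₁.1, h₂.2]⟩
  let l : Fin d := ⟨d - 1, by omega⟩
  let Q : (Fin (d - 1) → ℤ) → ℝ → Fin d → ℝ := fun p t i =>
    if hi : (i : ℕ) < d - 1 then (p ⟨i, hi⟩ : ℝ) else t
  have hQl : ∀ p t, Q p t l = t := fun p t => dif_neg (lt_irrefl _)
  let ι : Fin (d - 1) → Fin d := fun i => ⟨i, by omega⟩
  have hQ : ∀ p t i, Q p t (ι i) = p i := fun p t i => dif_pos i.2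
  have hιl : ∀ i, ι i ≠ l := fun i hi => by
    have := congrArg Fin.val hi
    simp only [ι, l] at this
    omega
  have hcase : ∀ i : Fin d, i = l ∨ ∃ j, i = ι j := fun i => by
    by_cases hi : (i : ℕ) < d - 1
    · exact Or.inr ⟨⟨i, hi⟩, rfl⟩
    · exact Or.inl (Fin.ext (by simp only [l]; omega))
  let Z : Set (Fin d → ℝ) := {x | x l ∉ Ioo (-(1 / 2) : ℝ) (1 / 2)}
  have hZ : ∀ z ∈ Z, 1 / 2 ≤ |z l| := fun z hz => by
    by_contra! hlt
    exact hz (abs_lt.1 hlt)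
  have hZ' : ∀ p, ∀ z ∈ Z, 3 / 8 ≤ |h p - z l| := fun p z hz => by
    have h₁ := abs_sub_abs_le_abs_sub (z l) (h p)
    rw [abs_sub_comm] at h₁
    linarith [hZ z hz, habs p]
  have hQv : ∀ p (s t : ℝ) i, |Q p s i - Q p t i| ≤ |s - t| := fun p s t i => by
    rcases hcase i with rfl | ⟨j, rfl⟩
    · rw [hQl, hQl]
    · rw [hQ, hQ, sub_self, abs_zero]; positivity
  have hQvv : ∀ p q (s t s' t' : ℝ) i, |(Q p s i - Q p t i) - (Q q s' i - Q q t' i)| ≤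
      |(s - t) - (s' - t')| := fun p q s t s' t' i => by
    rcases hcase i with rfl | ⟨j, rfl⟩
    · simp only [hQl, le_refl]
    · simp only [hQ, sub_self, abs_zero]; positivity
  have hone : ∀ p q : Fin (d - 1) → ℤ, p ≠ q → ∃ i, (1 : ℝ) ≤ |(p i : ℝ) - q i| := fun p q hne => by
    obtain ⟨i, hi⟩ := Function.ne_iff.1 hne
    exact ⟨i, by exact_mod_cast Int.one_le_abs (sub_ne_zero.2 hi)⟩
  obtain ⟨Φ₁, hΦ₁, hm₁, hz₁⟩ := exists_bilipschitz_shift_fixing univ le_rfl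
    (fun p => Q p 0) (fun p => Q p (h p)) Z (by simp)
    (fun p q hne => by
      obtain ⟨i, hi⟩ := hone p q hne
      refine Or.inl ⟨ι i, mem_univ _, fun j => (hQvv _ _ _ _ _ _ j).trans ?_⟩
      rw [hQ, hQ, sub_zero, sub_zero]
      linarith [hdiff p q])
    (fun p z hz => Or.inl ⟨l, mem_univ _, fun j => (hQv _ _ _ j).trans (by
      rw [hQl, zero_sub, abs_neg, sub_zero]
      linarith [hZ z hz, habs p])⟩)
  have hv : ∀ p i, |Q (σ p) (h p) i - Q p (h p) i| ≤ S := fun p i => by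
    rcases hcase i with rfl | ⟨j, rfl⟩
    · rw [hQl, hQl, sub_self, abs_zero]; positivity
    · rw [hQ, hQ]; exact hmove p j
  -- The horizontal move: different colours travel at heights at least `1/(8N)` apart, and equal
  -- colours are `4S` apart against a displacement difference of at most `2S`.
  obtain ⟨Φ₂, hΦ₂, hm₂, hz₂⟩ := exists_bilipschitz_shift_fixing {l}ᶜ (K := 16 * N * S)
    (by nlinarith) (fun p => Q p (h p)) (fun p => Q (σ p) (h p)) Z
    (fun p i hi => by
      obtain rfl : i = l := by simpa using hi
      simp only [hQl])
    (fun p q hne => by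
      have hvv : ∀ i, |(Q (σ p) (h p) i - Q p (h p) i) - (Q (σ q) (h q) i - Q q (h q) i)| ≤
          2 * S := fun i => (abs_sub _ _).trans (by linarith [hv p i, hv q i])
      by_cases hcc : c p = c q
      · obtain ⟨i, hi⟩ := hc p q hne hcc
        push_cast at hi
        refine Or.inl ⟨ι i, hιl i, fun j => (hvv j).trans ?_⟩
        rw [hQ, hQ]
        linarith
      · refine Or.inr ⟨l, by simp, fun j => (hvv j).trans ?_⟩
        rw [hQl, hQl]
        calc (2 * S : ℝ) = 16 * N * S * (1 / (8 * N)) := by field_simp; norm_num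
          _ ≤ _ := by gcongr; exact hsep p q hcc)
    (fun p z hz => Or.inr ⟨l, by simp, fun j => (hv p j).trans (by
      rw [hQl]
      have h₁ := hZ' p z hz
      have h₂ : (S : ℝ) ≤ N * S := le_mul_of_one_le_left (by positivity) hN1
      nlinarith)⟩)
  obtain ⟨Φ₃, hΦ₃, hm₃, hz₃⟩ := exists_bilipschitz_shift_fixing univ le_rfl
    (fun p => Q (σ p) (h p)) (fun p => Q (σ p) 0) Z (by simp)
    (fun p q hne => by
      obtain ⟨i, hi⟩ := hone (σ p) (σ q) (σ.injective.ne hne)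
      refine Or.inl ⟨ι i, mem_univ _, fun j => (hQvv _ _ _ _ _ _ j).trans ?_⟩
      rw [hQ, hQ, zero_sub, zero_sub, neg_sub_neg]
      linarith [hdiff q p])
    (fun p z hz => Or.inl ⟨l, mem_univ _, fun j => (hQv _ _ _ j).trans (by
      rw [hQl, zero_sub, abs_neg]
      linarith [hZ' p z hz, habs p])⟩)
  have hcomp := hΦ₃.comp (hΦ₂.comp hΦ₁ (by positivity) (by norm_num)) (by norm_num) (by positivity)
  refine ⟨_, (BilipschitzWith.toEuclidean (by positivity) hcomp).mono (le_of_eq (by ring)),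
    fun x hx => ?_, fun p => ?_⟩
  · have hxZ : x.ofLp ∈ Z := by
      rw [lastCoord_eq (by omega)] at hx
      exact hx
    simp only [Function.comp, hz₁ _ hxZ, hz₂ _ hxZ, hz₃ _ hxZ, WithLp.toLp_ofLp]
  · change (WithLp.toLp 2 (Φ₃ (Φ₂ (Φ₁ (Q p 0)))) : E d) = WithLp.toLp 2 (Q (σ p) 0)
    rw [hm₁, hm₂, hm₃]

/-- For fixed `d` the constant just obtained is polynomial in `S`, hence below the exponential.
Membership also makes the infimum defining `β_d` one over a nonempty set. -/
theorem two_rpow_mem_permFamily {d : ℕ} (hd : 2 ≤ d) :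
    (fun t : ℝ => (2 : ℝ) ^ (8 * (d : ℝ) * t)) ∈ permFamily d := by
  refine ⟨fun t ht => ?_, fun s hs t ht hst => ?_, fun S hS σ hσ => ?_⟩
  · have ht' : (1 : ℝ) ≤ t := ht
    exact Real.one_le_rpow one_le_two (by positivity)
  · exact Real.rpow_le_rpow_of_exponent_le one_le_two (by gcongr)
  · obtain ⟨Υ, hΥ, hout, hperm⟩ := exists_realises_tile_perm hd hS σ hσ
    refine ⟨Υ, hΥ.mono ?_, hout, hperm⟩
    have h₁ : (4 * S) ^ d ≤ 2 ^ ((2 + S) * d) := by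
      rw [pow_mul, pow_add]
      exact Nat.pow_le_pow_left (Nat.mul_le_mul le_rfl Nat.lt_two_pow_self.le) d
    have h₂ : 1 ≤ (4 * S) ^ d := Nat.one_le_pow _ _ (by omega)
    have h₃ : (4 * S) ^ d = (4 * S) ^ (d - 1) * (4 * S) := by
      rw [← pow_succ]; congr 1; omega
    have h₄ : d * (4 * (1 + 16 * (4 * S) ^ (d - 1) * S)) ≤ 2 ^ (8 * d * S) :=
      calc d * (4 * (1 + 16 * (4 * S) ^ (d - 1) * S)) = d * (4 * (1 + 4 * (4 * S) ^ d)) := by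
            rw [h₃]; ring
        _ ≤ 2 ^ d * (2 ^ 5 * 2 ^ ((2 + S) * d)) :=
            Nat.mul_le_mul Nat.lt_two_pow_self.le (by omega)
        _ = 2 ^ (d + (5 + (2 + S) * d)) := by rw [pow_add, pow_add]
        _ ≤ 2 ^ (8 * d * S) := Nat.pow_le_pow_right two_pos (by nlinarith)
    have h₅ : (2 : ℝ) ^ (8 * (d : ℝ) * S) = ((2 ^ (8 * d * S) : ℕ) : ℝ) := by
      rw [show 8 * (d : ℝ) * S = ((8 * d * S : ℕ) : ℝ) by push_cast; ring, Real.rpow_natCast]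
      push_cast; rfl
    refine le_trans ?_ h₅.ge
    exact_mod_cast h₄

/-! ### Lower bound and basic properties of `β_d` -/

/-- Reversing each tile in every coordinate moves two neighbouring points far apart. -/
theorem two_mul_sub_one_le_of_realisesTilePerms {d : ℕ} (hd : 2 ≤ d) {ψ : ℝ → ℝ}
    (hψ : RealisesTilePerms d ψ) {S : ℕ} (hS : 1 ≤ S) : 2 * (S : ℝ) - 1 ≤ ψ S := by
  have hS' : (0 : ℤ) < S := by exact_mod_cast hS
  let r : ℤ → ℤ := fun x => 2 * S * (x / S) + S - 1 - x
  have hrdiv : ∀ x, r x / S = x / S := fun x => by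
    have h₁ := Int.emod_add_mul_ediv x S
    have h₂ := Int.emod_nonneg x hS'.ne'
    have h₃ := Int.emod_lt_of_pos x hS'
    rw [Int.ediv_eq_iff_of_pos hS']
    simp only [r]
    constructor <;> nlinarith
  have hr : Function.Involutive r := fun x => by
    have := hrdiv x
    simp only [r] at this ⊢
    rw [this]; ring
  let ρ : (Fin (d - 1) → ℤ) → Fin (d - 1) → ℤ := fun p i => r (p i)
  have hρ : Function.Involutive ρ := fun p => funext fun i => hr (p i)
  obtain ⟨Υ, hΥ, -, hperm⟩ := hψ S hS hρ.toPerm fun z => Equiv.bijOn _ fun p => by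
    simp only [mem_tile_iff hS, Function.Involutive.coe_toPerm, ρ, hrdiv]
  let u : E d := atHeightZero fun _ => 1
  have hu : u ≠ 0 := fun h => by
    have h' := congrArg (fun x : E d => x.ofLp ⟨0, by omega⟩) h
    simp [u, atHeightZero, show 0 < d - 1 by omega] at h'
  have hdist : ∀ x y : ℤ, dist (atHeightZero (d := d) fun _ => x) (atHeightZero fun _ => y) =
      |(x : ℝ) - y| * ‖u‖ := fun x y => by
    rw [dist_eq_norm, ← Real.norm_eq_abs, ← norm_smul]
    congr 1
    ext i
    by_cases hi : (i : ℕ) < d - 1 <;> simp [u, atHeightZero, hi]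
  -- These diagonal neighbours lie on opposite sides of a tile corner; reversal sends them to the
  -- far ends `2S - 1` and `0`.
  have h := (hΥ (atHeightZero fun _ => S) (atHeightZero fun _ => S - 1)).1
  rw [hperm, hperm] at h
  simp only [Function.Involutive.coe_toPerm, ρ] at h
  rw [hdist, hdist] at h
  have e₁ : r S = 2 * S - 1 := by
    simp only [r, Int.ediv_self hS'.ne']; ring
  have e₂ : r (S - 1) = 0 := by
    have h₀ : ((S : ℤ) - 1) / S = 0 := Int.ediv_eq_zero_of_lt (by omega) (by omega)
    simp only [r, h₀]; ring
  rw [e₁, e₂] at h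
  push_cast at h
  rw [sub_zero, show (S : ℝ) - (S - 1) = 1 by ring, abs_one, one_mul] at h
  exact (le_abs_self _).trans (le_of_mul_le_mul_right h (norm_pos_iff.2 hu))

theorem betaFun_bddBelow {d : ℕ} {t : ℝ} (ht : 1 ≤ t) :
    BddBelow ((fun ψ : ℝ → ℝ => ψ t) '' permFamily d) := by
  refine ⟨1, ?_⟩
  rintro _ ⟨ψ, hψ, rfl⟩
  exact hψ.1 ht

theorem betaFun_le {d : ℕ} {t : ℝ} (ht : 1 ≤ t) {ψ : ℝ → ℝ} (hψ : ψ ∈ permFamily d) :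
    betaFun d t ≤ ψ t :=
  csInf_le (betaFun_bddBelow ht) ⟨ψ, hψ, rfl⟩

theorem le_betaFun {d : ℕ} (hd : 2 ≤ d) {t a : ℝ} (h : ∀ ψ ∈ permFamily d, a ≤ ψ t) :
    a ≤ betaFun d t := by
  refine le_csInf ⟨_, _, two_rpow_mem_permFamily hd, rfl⟩ ?_
  rintro _ ⟨ψ, hψ, rfl⟩
  exact h ψ hψ

theorem two_mul_floor_sub_one_le_betaFun {d : ℕ} (hd : 2 ≤ d) {t : ℝ} (ht : 1 ≤ t) :
    2 * (⌊t⌋ : ℝ) - 1 ≤ betaFun d t := by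
  refine le_betaFun hd fun ψ hψ => ?_
  have hS : 1 ≤ ⌊t⌋₊ := (Nat.one_le_floor_iff t).2 ht
  have h₁ := two_mul_sub_one_le_of_realisesTilePerms hd hψ.2.2 hS
  rw [natCast_floor_eq_intCast_floor (by linarith)] at h₁
  have h₂ : (1 : ℝ) ≤ ⌊t⌋ := by exact_mod_cast Int.le_floor.2 (by exact_mod_cast ht)
  exact h₁.trans (hψ.2.1 h₂ ht (Int.floor_le t))

/-! ### Lattice, hyperplanes and pullback along `G` -/

/-- The lattice point with integer coordinates `n`. -/
def latticePoint {d : ℕ} (n : Fin d → ℤ) : intLattice d :=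
  ⟨WithLp.toLp 2 fun i => (n i : ℝ), fun i => ⟨n i, rfl⟩⟩

theorem exists_latticePoint_eq {d : ℕ} (x : intLattice d) : ∃ n, latticePoint n = x := by
  choose n hn using x.2
  exact ⟨n, Subtype.ext (by ext i; exact (hn i).symm)⟩

theorem one_le_dist_latticePoint {d : ℕ} {n m : Fin d → ℤ} (h : n ≠ m) :
    1 ≤ dist (latticePoint n) (latticePoint m) := by
  obtain ⟨i, hi⟩ := Function.ne_iff.1 h
  have h₁ : (1 : ℝ) ≤ |(n i : ℝ) - m i| := by
    exact_mod_cast Int.one_le_abs (sub_ne_zero.2 hi)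
  exact h₁.trans (PiLp.dist_apply_le (latticePoint n : E d) (latticePoint m) i)

theorem not_mem_intLattice_of_mem_hyperplanes {d T : ℕ} (hd : 0 < d) {x : E d}
    (hx : x ∈ hyperplanes d T) : x ∉ intLattice d := fun h => by
  obtain ⟨k, hk⟩ := hx
  obtain ⟨n, hn⟩ := h ⟨d - 1, by omega⟩
  rw [lastCoord_eq hd, hn] at hk
  have h₁ : (2 : ℝ) * n = 2 * (T * k) + 1 := by linarith
  have h₂ : 2 * n = 2 * (T * k) + 1 := by exact_mod_cast h₁
  omega

theorem joint_of_mem_intLattice {d : ℕ} (f : intLattice d → E d) (G : E d → E d) (T : ℕ)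
    (x : intLattice d) : joint f G T ⟨x, Or.inl x.2⟩ = f x :=
  dif_pos x.2

theorem joint_of_mem_hyperplanes {d : ℕ} (hd : 0 < d) (f : intLattice d → E d) (G : E d → E d)
    (T : ℕ) {x : E d} (hx : x ∈ hyperplanes d T) : joint f G T ⟨x, Or.inr hx⟩ = G x :=
  dif_neg (not_mem_intLattice_of_mem_hyperplanes hd hx)

theorem joint_eq_of_extends {d : ℕ} {f : intLattice d → E d} {F : E d → E d}
    (hF : ∀ x : intLattice d, F x = f x) (T : ℕ) : joint f F T = fun x : ↥(intLattice d ∪ hyperplanes d T) => F x := by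
  funext x
  by_cases hx : (x : E d) ∈ intLattice d
  · exact (dif_pos hx).trans (hF ⟨x, hx⟩).symm
  · exact dif_neg hx

/-- Every lattice point lies in a slab whose upper face is at distance at most `T`. -/
theorem exists_slab_near {d T : ℕ} (hd : 0 < d) (hT : 1 ≤ T) (x : intLattice d) :
    ∃ k : ℤ, (x : E d) ∈ slab d T k ∧ ∃ y ∈ hyperplanes d T, dist (x : E d) y ≤ T := by
  have hT' : (0 : ℝ) < T := by exact_mod_cast hT
  set l : Fin d := ⟨d - 1, by omega⟩
  set j : ℝ := lastCoord (x : E d)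
  set k : ℤ := ⌈(j - 1 / 2) / T⌉
  have h₁ : j - 1 / 2 ≤ k * T := (div_le_iff₀ hT').1 (Int.le_ceil _)
  have h₂ : ((k : ℝ) - 1) * T < j - 1 / 2 :=
    (lt_div_iff₀ hT').1 (by linarith [Int.ceil_lt_add_one ((j - 1 / 2) / T)])
  refine ⟨k, ⟨by linarith, by linarith⟩, (x : E d) + (PiLp.single 2 l (T * k + 1 / 2 - j) : E d), ⟨k, ?_⟩, ?_⟩
  · have : j = (x : E d) l := lastCoord_eq hd _
    rw [lastCoord_eq hd, PiLp.add_apply, PiLp.single_apply, if_pos rfl, this]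
    ring
  · rw [dist_self_add_right, PiLp.norm_single, Real.norm_eq_abs,
      abs_of_nonneg (by linarith)]
    linarith

/-- Pulling `f` back through `G` yields a separated map `g` near the inclusion; `G` composed with an
extension of `g` extends `f`. -/
theorem exists_extension_of_joint {d : ℕ} (hd : 2 ≤ d) (f : intLattice d → E d) {T : ℕ}
    (hT : 1 ≤ T) {G : E d → E d} {M₁ M₂ : ℝ} (hM₁ : BilipschitzWith M₁ (joint f G T))
    (hM₂ : BilipschitzWith M₂ G) (hfG : SlabCompatible f G T) :
    1 ≤ M₁ * M₂ ∧ ∃ F : E d → E d, (∀ x : intLattice d, F x = f x) ∧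
      BilipschitzWith ((2 ^ 5 * d * (M₁ * M₂) * T) ^ (2 * d + 4)) F := by
  have hT1 : (1 : ℝ) ≤ T := by exact_mod_cast hT
  have hd1 : (1 : ℝ) ≤ d := by exact_mod_cast (by omega : 1 ≤ d)
  have hne : (fun _ => 0 : Fin d → ℤ) ≠ fun _ => 1 := fun h => by
    simpa using congrFun h ⟨0, by omega⟩
  have hpt : latticePoint (fun _ => 0 : Fin d → ℤ) ≠ latticePoint fun _ => 1 := fun h => by
    have := one_le_dist_latticePoint hne
    rw [h, dist_self] at this
    linarith
  have h1 : 1 ≤ M₁ := one_le_of_bilipschitzWith hM₁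
    (x := ⟨_, Or.inl (latticePoint fun _ => 0).2⟩) (y := ⟨_, Or.inl (latticePoint fun _ => 1).2⟩)
    fun h => hpt (Subtype.ext (Subtype.mk.inj h))
  have h2 : 1 ≤ M₂ := one_le_of_bilipschitzWith hM₂ fun h => hpt (Subtype.ext h)
  set M := M₁ * M₂ with hM
  have hM1 : 1 ≤ M := one_le_mul_of_one_le_of_one_le h1 h2
  have hM2 : M₂ ≤ M := le_mul_of_one_le_left (by linarith) h1
  refine ⟨hM1, ?_⟩
  choose k hk y hy hky using fun n : Fin d → ℤ =>
    exists_slab_near (by omega : 0 < d) hT (latticePoint n)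
  choose g _ hg using fun n : Fin d → ℤ => hfG (k n) (mem_image_of_mem f (hk n))
  have hfdist : ∀ n m, dist (latticePoint n) (latticePoint m) ≤ M * dist (g n) (g m) :=
    fun n m => by
    have h₁ := (hM₁ ⟨_, Or.inl (latticePoint n).2⟩ ⟨_, Or.inl (latticePoint m).2⟩).2
    rw [joint_of_mem_intLattice, joint_of_mem_intLattice, ← hg, ← hg] at h₁
    calc dist (latticePoint n) (latticePoint m) ≤ M₁ * dist (G (g n)) (G (g m)) := h₁
      _ ≤ M₁ * (M₂ * dist (g n) (g m)) := by gcongr; exact (hM₂ _ _).1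
      _ = M * dist (g n) (g m) := by rw [hM]; ring
  have hnear : ∀ n, dist (g n) (latticePoint n : E d) ≤ 2 * M * T := fun n => by
    have h₁ := (hM₁ ⟨_, Or.inl (latticePoint n).2⟩ ⟨_, Or.inr (hy n)⟩).1
    rw [joint_of_mem_intLattice, joint_of_mem_hyperplanes (by omega) f G T (hy n), ← hg] at h₁
    -- The hyperplane point `y n` anchors `g n`: it is within `T` of the lattice point, and the
    -- joint map equals `G` there.
    have h₂ : dist (g n) (y n) ≤ M * T :=
      calc dist (g n) (y n) ≤ M₂ * dist (G (g n)) (G (y n)) := (hM₂ _ _).2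
        _ ≤ M₂ * (M₁ * dist (latticePoint n : E d) (y n)) := by gcongr; exact h₁
        _ ≤ M₂ * (M₁ * T) := by gcongr; exact hky n
        _ = M * T := by rw [hM]; ring
    have h₃ := dist_triangle_right (g n) (latticePoint n : E d) (y n)
    nlinarith [hky n]
  -- Euclidean separation is `1/M`; the factor `d` pays for passing to the supremum norm.
  set δ : ℝ := 1 / (M * d) with hδ
  have hδ0 : 0 < δ := by positivity
  have hsep : ∀ n m, n ≠ m → ∃ i, δ ≤ |g n i - g m i| := fun n m hnm => by
    by_contra! hlt
    have h₁ : dist (g n).ofLp (g m).ofLp < δ := (dist_pi_lt_iff hδ0).2 hlt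
    have h₂ := (one_le_dist_latticePoint hnm).trans (hfdist n m)
    have h₃ : M * dist (g n) (g m) < 1 :=
      calc M * dist (g n) (g m) ≤ M * (d * dist (g n).ofLp (g m).ofLp) := by
            gcongr; exact dist_le_mul_dist_ofLp _ _
        _ < M * (d * δ) := by gcongr
        _ = 1 := by rw [hδ]; field_simp
    linarith
  have hR : 4 * (2 * M * T + 1) ≤ ((⌈4 * (2 * M * T + 1)⌉₊ : ℕ) : ℝ) := Nat.le_ceil _
  have hRlt := Nat.ceil_lt_add_one (show 0 ≤ 4 * (2 * M * T + 1) by positivity)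
  set R : ℕ := ⌈4 * (2 * M * T + 1)⌉₊
  obtain ⟨Φ, hΦ, hΦn⟩ := exists_bilipschitz_extension
    (k := (⟨0, by omega⟩ : Fin d)) (l := ⟨1, by omega⟩) (by simp) (fun n => (g n).ofLp) hδ0
    (by rw [hδ, div_le_one (by positivity)]; nlinarith)
    (fun n i => (PiLp.dist_apply_le (g n) (latticePoint n : E d) i).trans (hnear n)) hsep hR
  rw [Fintype.card_fin] at hΦ
  have hΨ := hM₂.comp (hΦ.toEuclidean (by positivity)) (by linarith) (by positivity)
  refine ⟨_, fun x => ?_, hΨ.mono ?_⟩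
  · obtain ⟨n, rfl⟩ := exists_latticePoint_eq x
    have : Φ (latticePoint n : E d).ofLp = (g n).ofLp := hΦn n
    simp only [Function.comp, this, WithLp.toLp_ofLp, hg]
  · have hMT : 1 ≤ M * T := one_le_mul_of_one_le_of_one_le hM1 hT1
    have hdMT : 1 ≤ d * (M * T) := one_le_mul_of_one_le_of_one_le hd1 hMT
    set B : ℝ := 2 ^ 5 * d * M * T with hB
    have hBMT : 32 * (M * T) ≤ B := by
      rw [hB]; nlinarith
    have hRB : (R : ℝ) ≤ B := by nlinarith
    have hP1 : (1 : ℝ) ≤ B ^ d := one_le_pow₀ (by linarith)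
    have hRd : (R : ℝ) ^ d ≤ B ^ d := by gcongr
    have hD : 2 * M * T + 1 ≤ 3 * (M * T) := by linarith
    have e₁ : 1 + 4 * (R : ℝ) ^ d * (2 * M * T + 1) ≤ B ^ d * B :=
      calc 1 + 4 * (R : ℝ) ^ d * (2 * M * T + 1) ≤ B ^ d * (M * T) + 4 * B ^ d * (3 * (M * T)) := by
            gcongr
            exact one_le_mul_of_one_le_of_one_le hP1 hMT
        _ = B ^ d * (13 * (M * T)) := by ring
        _ ≤ B ^ d * B := by gcongr; linarith
    have e₂ : 1 + 16 * (R : ℝ) ^ d * (2 * M * T + 1) / δ ≤ B ^ d * B ^ 2 :=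
      calc 1 + 16 * (R : ℝ) ^ d * (2 * M * T + 1) / δ
          = 1 + 16 * (R : ℝ) ^ d * (2 * M * T + 1) * (M * d) := by rw [hδ]; field_simp
        _ ≤ B ^ d * (M * (d * (M * T))) + 16 * B ^ d * (3 * (M * T)) * (M * d) := by
            gcongr
            exact one_le_mul_of_one_le_of_one_le hP1 (one_le_mul_of_one_le_of_one_le hM1 hdMT)
        _ = B ^ d * ((M * T) * (49 * d * M)) := by ring
        _ ≤ B ^ d * (B / 2 * (2 * B)) := by
            have h₁ : d * M ≤ d * M * T := le_mul_of_one_le_right (by positivity) hT1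
            refine mul_le_mul_of_nonneg_left (mul_le_mul ?_ ?_ ?_ ?_) (by positivity)
            · linarith
            · rw [hB]; linarith
            · positivity
            · positivity
        _ = B ^ d * B ^ 2 := by ring
    have e₃ : M₂ * d * 4 ≤ B := by
      have h₁ : M₂ * d ≤ M * d := by gcongr
      have h₂ : M * d ≤ M * d * T := le_mul_of_one_le_right (by positivity) hT1
      rw [hB]; nlinarith
    calc M₂ * (d * (4 * (1 + 4 * (R : ℝ) ^ d * (2 * M * T + 1)) *
          (1 + 16 * (R : ℝ) ^ d * (2 * M * T + 1) / δ)))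
        = M₂ * d * 4 * (1 + 4 * (R : ℝ) ^ d * (2 * M * T + 1)) *
          (1 + 16 * (R : ℝ) ^ d * (2 * M * T + 1) / δ) := by ring
      _ ≤ B * (B ^ d * B) * (B ^ d * B ^ 2) := by gcongr
      _ = B ^ (2 * d + 4) := by ring

end BilipExt

/-! ### Assembly and comparison of constants -/

theorem theorem1p2 (d : ℕ) (hd : 2 ≤ d) :
    (MapsTo (BilipExt.betaFun d) (Ici 1) (Ici 1) ∧
      MonotoneOn (BilipExt.betaFun d) (Ici 1) ∧
      ∀ t : ℝ, 1 ≤ t →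
        2 * (⌊t⌋ : ℝ) - 1 ≤ BilipExt.betaFun d t ∧
          BilipExt.betaFun d t ≤ (2 : ℝ) ^ (8 * (d : ℝ) * t)) ∧
    ∀ f : BilipExt.intLattice d → BilipExt.E d, BilipExt.Bilipschitz f →
      ((∃ F : BilipExt.E d → BilipExt.E d,
          BilipExt.Bilipschitz F ∧ ∀ x : BilipExt.intLattice d, F x = f x) ↔
        ∃ T : ℕ, 1 ≤ T ∧ ∃ G : BilipExt.E d → BilipExt.E d, BilipExt.Bilipschitz G ∧
          BilipExt.Bilipschitz (BilipExt.joint f G T) ∧ BilipExt.SlabCompatible f G T) ∧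
      ∀ (T : ℕ) (G : BilipExt.E d → BilipExt.E d) (M₁ M₂ : ℝ), 1 ≤ T →
        BilipExt.BilipschitzWith M₁ (BilipExt.joint f G T) →
        BilipExt.BilipschitzWith M₂ G →
        BilipExt.SlabCompatible f G T →
        ∃ F : BilipExt.E d → BilipExt.E d, (∀ x : BilipExt.intLattice d, F x = f x) ∧
          BilipExt.BilipschitzWith
            (BilipExt.betaFun d
              ((2 : ℝ) ^ 42 * (d : ℝ) ^ ((9 : ℝ) / 2) * (M₁ * M₂) ^ 10 *
                (T : ℝ) ^ (3 + 3 / ((d : ℝ) - 1))) ^ (3 ^ (d - 1) + 1)) F := by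
  refine ⟨⟨fun t ht => BilipExt.le_betaFun hd fun ψ hψ => hψ.1 ht,
    fun s hs t ht hst => BilipExt.le_betaFun hd fun ψ hψ =>
      (BilipExt.betaFun_le hs hψ).trans (hψ.2.1 hs ht hst),
    fun t ht => ⟨BilipExt.two_mul_floor_sub_one_le_betaFun hd ht,
      BilipExt.betaFun_le ht (BilipExt.two_rpow_mem_permFamily hd)⟩⟩, fun f _ => ⟨⟨?_, ?_⟩, ?_⟩⟩
  · rintro ⟨F, ⟨L, hL, hF⟩, hFf⟩
    -- An extension `F` serves as its own `G`, with `T = 1`.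
    refine ⟨1, le_rfl, F, ⟨L, hL, hF⟩, ⟨L, hL, ?_⟩, fun k => ?_⟩
    · rw [BilipExt.joint_eq_of_extends hFf]
      exact fun x y => hF x y
    · rintro _ ⟨x, hx, rfl⟩
      exact ⟨x, hx, hFf x⟩
  · rintro ⟨T, hT, G, ⟨M₂, -, hM₂⟩, ⟨M₁, -, hM₁⟩, hfG⟩
    obtain ⟨hM, F, hFf, hF⟩ := BilipExt.exists_extension_of_joint hd f hT hM₁ hM₂ hfG
    have hT1 : (1 : ℝ) ≤ T := by exact_mod_cast hT
    have hd1 : (1 : ℝ) ≤ d := by exact_mod_cast (by omega : 1 ≤ d)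
    refine ⟨F, ⟨_, one_le_pow₀ ?_, hF⟩, hFf⟩
    have := one_le_mul_of_one_le_of_one_le (one_le_mul_of_one_le_of_one_le hd1 hM) hT1
    linarith
  · intro T G M₁ M₂ hT hM₁ hM₂ hfG
    obtain ⟨hM, F, hFf, hF⟩ := BilipExt.exists_extension_of_joint hd f hT hM₁ hM₂ hfG
    refine ⟨F, hFf, hF.mono ?_⟩
    set M := M₁ * M₂
    have hT1 : (1 : ℝ) ≤ T := by exact_mod_cast hT
    have hd2 : (2 : ℝ) ≤ d := by exact_mod_cast hd
    set t : ℝ := (2 : ℝ) ^ 42 * (d : ℝ) ^ ((9 : ℝ) / 2) * M ^ 10 *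
      (T : ℝ) ^ (3 + 3 / ((d : ℝ) - 1)) with ht
    have hBt : (2 ^ 5 * d * M * T) ^ 2 ≤ t := by
      have e₁ : (d : ℝ) ^ 2 ≤ (d : ℝ) ^ ((9 : ℝ) / 2) := by
        rw [← Real.rpow_natCast]
        exact Real.rpow_le_rpow_of_exponent_le (by linarith) (by norm_num)
      have e₂ : (T : ℝ) ^ 2 ≤ (T : ℝ) ^ (3 + 3 / ((d : ℝ) - 1)) := by
        rw [← Real.rpow_natCast]
        have : 0 ≤ 3 / ((d : ℝ) - 1) := div_nonneg (by norm_num) (by linarith)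
        exact Real.rpow_le_rpow_of_exponent_le hT1 (by push_cast; linarith)
      have e₃ : M ^ 2 ≤ M ^ 10 := pow_le_pow_right₀ hM (by norm_num)
      calc (2 ^ 5 * d * M * T) ^ 2 = (2 : ℝ) ^ 10 * d ^ 2 * M ^ 2 * T ^ 2 := by ring
        _ ≤ t := by
          rw [ht]
          gcongr
          · norm_num
          · norm_num
    have hB1 : 2 ≤ 2 ^ 5 * d * M * T := by
      have := one_le_mul_of_one_le_of_one_le
        (one_le_mul_of_one_le_of_one_le (by linarith : 1 ≤ (d : ℝ)) hM) hT1
      linarith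
    have ht3 : 3 ≤ t := by nlinarith
    -- `2⌊t⌋ - 1 > 2t - 3 ≥ t`, using `t ≥ 3`.
    have hβ : t ≤ BilipExt.betaFun d t := by
      have h₁ := BilipExt.two_mul_floor_sub_one_le_betaFun hd (by linarith : 1 ≤ t)
      linarith [Int.lt_floor_add_one t]
    -- Bernoulli gives `3^(d-1) ≥ 2d - 1`, which is at least `d + 1` because `d ≥ 2`.
    have hexp : d + 2 ≤ 3 ^ (d - 1) + 1 := by
      have h₁ := one_add_mul_le_pow (R := ℤ) (a := 2) (by norm_num) (d - 1)
      have h₂ : 1 + (d - 1) * 2 ≤ 3 ^ (d - 1) := by exact_mod_cast h₁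
      omega
    calc (2 ^ 5 * d * M * T) ^ (2 * d + 4) = ((2 ^ 5 * d * M * T) ^ 2) ^ (d + 2) := by
          rw [← pow_mul, mul_add]
      _ ≤ t ^ (d + 2) := by gcongr
      _ ≤ t ^ (3 ^ (d - 1) + 1) := pow_le_pow_right₀ (by linarith) hexp
      _ ≤ _ := by gcongr
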